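/- Let $X$ be a crowded Polish space, that is, a non-empty separable completely metrizable topological space without isolated points. A relation on $X$ is a set $R\subseteq X^{n}$ for some integer $n=n_R\ge 1$; it is meager if it is a meager subset of $X^{n_R}$. Let $\mathsf{add(meager)}$ denote the minimal size of a collection of meager subsets of $2^\omega$ whose union is non-meager in $2^\omega$. Let $\mathcal{R}$ be a collection of meager relations on $X$ (of possibly different arities) such that $|\mathcal{R}|<\mathsf{add(meager)}$. Then there exists $F\subseteq X$ such that $F\cap U$ is non-meager in $X$ for every non-empty open $U\subseteq X$ (that is, $F$ is nowhere meager in $X$), and $F$ is $\mathcal{R}$-free: for every $R\in\mathcal{R}$ and all pairwise distinct $x_0,\dots,x_{n_R-1}\in F$, one has $(x_0,\dots,x_{n_R-1})\notin R$. -/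

import Mathlib

universe u

/-- A finitary relation on `X`: a subset of `X ^ n` for some `1 ≤ n < ω`. -/
structure FinRel (X : Type u) where
  /-- The arity `n` of the relation. -/
  arity : ℕ
  /-- The arity is at least `1`. -/
  one_le_arity : 1 ≤ arity
  /-- The underlying subset of `X ^ n`. -/
  carrier : Set (Fin arity → X)

namespace FinRel

/-- A relation of arity `n` is meager if it is a meager subset of `X ^ n` (product topology). -/
def Meager {X : Type u} [TopologicalSpace X] (R : FinRel X) : Prop :=
  IsMeagre R.carrier

/-- `F` is `R`-free if no injective `x : n → F` belongs to `R`. -/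
def IsFree {X : Type u} (R : FinRel X) (F : Set X) : Prop :=
  ∀ x : Fin R.arity → X, (∀ i, x i ∈ F) → Function.Injective x → x ∉ R.carrier

end FinRel

/-- `F` is free for a collection of relations if it is free for each of them. -/
def IsFreeFor {X : Type u} (Rs : Set (FinRel X)) (F : Set X) : Prop :=
  ∀ R ∈ Rs, R.IsFree F

/-- `S` is nowhere meager in `X` if `S ∩ U` is non-meager in `X` for every non-empty open `U`. -/
def NowhereMeager {X : Type u} [TopologicalSpace X] (S : Set X) : Prop :=
  ∀ U : Set X, IsOpen U → U.Nonempty → ¬ IsMeagre (S ∩ U)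

/-- `add(meager)`: the minimal size of a collection of meager subsets of the Cantor space
whose union is non-meager. -/
noncomputable def addMeager : Cardinal.{0} :=
  sInf {κ : Cardinal.{0} | ∃ M : Set (Set (ℕ → Bool)),
    (∀ S ∈ M, IsMeagre S) ∧ ¬ IsMeagre (⋃₀ M) ∧ Cardinal.mk M = κ}

open Set Filter Topology

section Cardinal

theorem aleph0_lt_addMeager (h : addMeager ≠ 0) : Cardinal.aleph0 < addMeager := by
  have hne : {κ : Cardinal.{0} | ∃ M : Set (Set (ℕ → Bool)),
      (∀ S ∈ M, IsMeagre S) ∧ ¬ IsMeagre (⋃₀ M) ∧ Cardinal.mk M = κ}.Nonempty := by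
    by_contra hcon
    rw [Set.not_nonempty_iff_eq_empty] at hcon
    exact h (by rw [addMeager, hcon, Cardinal.sInf_empty])
  obtain ⟨M, hM, hU, hc⟩ := csInf_mem hne
  by_contra hcon
  have hle : Cardinal.mk M ≤ Cardinal.aleph0 := hc.trans_le (not_lt.mp hcon)
  have : M.Countable := Cardinal.le_aleph0_iff_set_countable.mp hle
  apply hU
  rw [Set.sUnion_eq_biUnion]
  exact isMeagre_biUnion this hM

/-- Fewer than `add(meager)` meager subsets of the Cantor space do not cover it. -/
theorem exists_notMem_of_lt_addMeager {ι : Type u} (B : ι → Set (ℕ → Bool))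
    (hB : ∀ i, IsMeagre (B i)) (hcard : Cardinal.mk ι < Cardinal.lift.{u} addMeager) :
    ∃ c, ∀ i, c ∉ B i := by
  have hmeagre : IsMeagre (⋃₀ Set.range B) := by
    by_contra hcon
    have h1 : addMeager ≤ Cardinal.mk (Set.range B) :=
      csInf_le' ⟨Set.range B, by rintro _ ⟨i, rfl⟩; exact hB i, hcon, rfl⟩
    have h2 : Cardinal.lift.{u} (Cardinal.mk (Set.range B)) ≤ Cardinal.mk ι := by
      simpa using Cardinal.mk_range_le_lift (f := B)
    exact absurd ((Cardinal.lift_le.mpr h1).trans h2) (not_le.mpr hcard)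
  by_contra! hcon
  refine not_isMeagre_of_isOpen (X := ℕ → Bool) isOpen_univ univ_nonempty
    (hmeagre.mono fun c _ => ?_)
  obtain ⟨i, hi⟩ := hcon c
  exact ⟨_, ⟨i, rfl⟩, hi⟩

theorem mk_finset_prod_nat_lt {α : Type u} (h : Cardinal.mk α < Cardinal.lift.{u} addMeager) :
    Cardinal.mk (Finset (α × ℕ) × ℕ) < Cardinal.lift.{u} addMeager := by
  have h0 : addMeager ≠ 0 := by
    intro h0
    simp [h0] at h
  have hal : Cardinal.aleph0 < Cardinal.lift.{u} addMeager :=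
    Cardinal.aleph0_lt_lift.mpr (aleph0_lt_addMeager h0)
  have h1 : Cardinal.mk (α × ℕ) < Cardinal.lift.{u} addMeager := by
    rw [Cardinal.mk_prod]
    exact Cardinal.mul_lt_of_lt hal.le (by simpa using h) (by simpa using hal)
  have h2 : Cardinal.mk (Finset (α × ℕ)) ≤ Cardinal.mk (List (α × ℕ)) :=
    Cardinal.mk_le_of_injective (f := Finset.toList) fun s t h => by
      simpa using congrArg (fun l : List (α × ℕ) => (l : Multiset (α × ℕ))) h
  have h3 : Cardinal.mk (Finset (α × ℕ)) < Cardinal.lift.{u} addMeager :=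
    (h2.trans (Cardinal.mk_list_le_max _)).trans_lt (max_lt hal h1)
  rw [Cardinal.mk_prod]
  exact Cardinal.mul_lt_of_lt hal.le (by simpa using h3) (by simpa using hal)

end Cardinal

section Generic

variable {P : Type}

open Classical in
/-- One step of decoding a binary sequence into a chain of conditions: `true` increments a counter,
`false` tries to move to the condition named by the counter and resets the counter. -/
noncomputable def decodeStep (r : P → P → Prop) (e : ℕ → P) (s : P × ℕ) (b : Bool) : P × ℕ :=
  if b then (s.1, s.2 + 1) else (if r s.1 (e s.2) then e s.2 else s.1, 0)

/-- The state reached after reading the first `t` bits of `c`. -/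
noncomputable def decodeState (r : P → P → Prop) (e : ℕ → P) (p₀ : P) (c : ℕ → Bool) : ℕ → P × ℕ
  | 0 => (p₀, 0)
  | t + 1 => decodeStep r e (decodeState r e p₀ c t) (c t)

variable {r : P → P → Prop} {e : ℕ → P} {p₀ : P}

theorem decodeState_congr {c d : ℕ → Bool} {t : ℕ} (h : ∀ i < t, c i = d i) :
    decodeState r e p₀ c t = decodeState r e p₀ d t := by
  induction t with
  | zero => rfl
  | succ t ih =>
    rw [decodeState, decodeState, ih fun i hi => h i (by omega), h t (by omega)]

theorem decodeState_add_of_true {c : ℕ → Bool} {t : ℕ} (j : ℕ)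
    (h : ∀ i, t ≤ i → i < t + j → c i = true) :
    decodeState r e p₀ c (t + j) =
      ((decodeState r e p₀ c t).1, (decodeState r e p₀ c t).2 + j) := by
  induction j with
  | zero => rfl
  | succ j ih =>
    rw [← add_assoc, decodeState, ih fun i h1 h2 => h i h1 (by omega),
      h (t + j) (by omega) (by omega)]
    simp [decodeStep, add_assoc]

theorem decodeState_succ_of_false {c : ℕ → Bool} {t : ℕ} (h : c t = false) :
    (decodeState r e p₀ c (t + 1)).2 = 0 := by
  rw [decodeState, h]
  simp [decodeStep]

theorem decodeState_rel (hrefl : ∀ p, r p p) (c : ℕ → Bool) (t : ℕ) :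
    r (decodeState r e p₀ c t).1 (decodeState r e p₀ c (t + 1)).1 := by
  rw [decodeState]
  unfold decodeStep
  split_ifs with h1 h2
  · exact hrefl _
  · exact h2
  · exact hrefl _

theorem isOpen_decodeState_mem (D : Set P) :
    IsOpen {c : ℕ → Bool | ∃ t, (decodeState r e p₀ c t).1 ∈ D} := by
  rw [isOpen_iff_mem_nhds]
  rintro c ⟨t, ht⟩
  have hcyl := (PiNat.isOpen_cylinder (fun _ => Bool) c t).mem_nhds (PiNat.self_mem_cylinder c t)
  filter_upwards [hcyl] with d hd
  refine ⟨t, ?_⟩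
  rwa [decodeState_congr (d := c) fun i hi => hd i hi]

theorem dense_decodeState_mem (he : Function.Surjective e) {D : Set P}
    (hD : ∀ p, ∃ q ∈ D, r p q) :
    Dense {c : ℕ → Bool | ∃ t, (decodeState r e p₀ c t).1 ∈ D} := by
  classical
  rw [(PiNat.isTopologicalBasis_cylinders fun _ : ℕ => Bool).dense_iff]
  rintro _ ⟨c, t, rfl⟩ -
  let c₀ : ℕ → Bool := fun i => if i < t then c i else false
  obtain ⟨q, hq, hrq⟩ := hD (decodeState r e p₀ c₀ (t + 1)).1
  obtain ⟨j, rfl⟩ := he q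
  let d : ℕ → Bool := fun i => if i < t then c i else decide (t < i ∧ i < t + 1 + j)
  have h1 : decodeState r e p₀ d (t + 1) = decodeState r e p₀ c₀ (t + 1) := by
    refine decodeState_congr fun i hi => ?_
    by_cases hit : i < t
    · simp [c₀, d, hit]
    · have : ¬ t < i := by omega
      simp [c₀, d, hit, this]
  have h2 := decodeState_add_of_true (r := r) (e := e) (p₀ := p₀) (c := d) (t := t + 1) j
    fun i hi hij => by
      have h3 : ¬ i < t := by omega
      have h4 : t < i := by omega
      simp [d, h3, h4, hij]
  rw [h1, decodeState_succ_of_false (show c₀ t = false by simp [c₀]), zero_add] at h2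
  have h5 : d (t + 1 + j) = false := by
    have h3 : ¬ t + 1 + j < t := by omega
    simp [d, h3]
  refine ⟨d, fun i hi => by simp [d, hi], t + 1 + j + 1, ?_⟩
  rw [decodeState, h2, h5]
  simpa [decodeStep, hrq] using hq

/-- Fewer than `add(meager)` dense subsets of a countable forcing notion are met by a single
chain of conditions. -/
theorem exists_generic_chain [Countable P] [Nonempty P] {ι : Type u} (r : P → P → Prop)
    (hrefl : ∀ p, r p p) (D : ι → Set P) (hD : ∀ i p, ∃ q ∈ D i, r p q)
    (hcard : Cardinal.mk ι < Cardinal.lift.{u} addMeager) :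
    ∃ p : ℕ → P, (∀ t, r (p t) (p (t + 1))) ∧ ∀ i, ∃ t, p t ∈ D i := by
  obtain ⟨e, he⟩ := exists_surjective_nat P
  have p₀ : P := Classical.arbitrary P
  obtain ⟨c, hc⟩ := exists_notMem_of_lt_addMeager
    (fun i => {c : ℕ → Bool | ∃ t, (decodeState r e p₀ c t).1 ∈ D i}ᶜ)
    (fun i => by
      rw [IsMeagre, compl_compl]
      exact residual_of_dense_open (isOpen_decodeState_mem _) (dense_decodeState_mem he (hD i)))
    hcard
  exact ⟨fun t => (decodeState r e p₀ c t).1, decodeState_rel hrefl c,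
    fun i => not_not.mp (hc i)⟩

end Generic


section Density

variable {X : Type u} [MetricSpace X]

/-- Every `ε`-separated `n`-tuple of points of `W` lies in `G`. -/
def SeparatedTuplesIn (W : Set X) (ε : ℝ) {n : ℕ} (G : Set (Fin n → X)) : Prop :=
  ∀ x : Fin n → X, (∀ i, x i ∈ W) → (∀ i j, i ≠ j → ε < dist (x i) (x j)) → x ∈ G

theorem Dense.preimage_comp_injective {ι κ : Type*} [Fintype ι] [Fintype κ] {t : κ → ι}
    (ht : Function.Injective t) {G : Set (κ → X)} (hG : Dense G) :
    Dense {w : ι → X | w ∘ t ∈ G} := by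
  intro w
  rw [Metric.mem_closure_iff]
  intro δ hδ
  obtain ⟨y, hy, hyd⟩ := Metric.mem_closure_iff.mp (hG (w ∘ t)) δ hδ
  refine ⟨Function.extend t y w, ?_, ?_⟩
  · change Function.extend t y w ∘ t ∈ G
    rwa [Function.extend_comp ht]
  · rw [dist_pi_lt_iff hδ] at hyd ⊢
    intro i
    by_cases hi : ∃ k, t k = i
    · obtain ⟨k, rfl⟩ := hi
      rw [ht.extend_apply]
      exact hyd k
    · rw [Function.extend_apply' _ _ _ hi, dist_self]
      exact hδ

/-- Finitely many non-empty open sets can be met by a single finite union of basic open sets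
all of whose separated tuples lie in given dense open sets. -/
theorem exists_finset_separatedTuplesIn [CompleteSpace X] {B : ℕ → Set X}
    (hB : TopologicalSpace.IsTopologicalBasis (range B)) {S : Set (Set X)} (hS : S.Finite)
    (hSo : ∀ V ∈ S, IsOpen V) (hSn : ∀ V ∈ S, V.Nonempty)
    {α : Type*} (E : Finset α) (n : α → ℕ) (G : ∀ a, Set (Fin (n a) → X))
    (hGo : ∀ a, IsOpen (G a)) (hGd : ∀ a, Dense (G a)) {ε : ℝ} (hε : 0 < ε) :
    ∃ s : Finset ℕ, (∀ V ∈ S, (V ∩ ⋃ i ∈ s, B i).Nonempty) ∧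
      ∀ a ∈ E, SeparatedTuplesIn (⋃ i ∈ s, B i) ε (G a) := by
  classical
  have := hS.fintype
  let T := Σ a : E, {t : Fin (n a) → S // Function.Injective t}
  let Q : T → Set (S → X) := fun t => {w | w ∘ t.2.1 ∈ G t.1}
  have hQo : ∀ t, IsOpen (Q t) := fun t => (hGo t.1).preimage (by fun_prop)
  have hQd : Dense (⋂ t, Q t) :=
    dense_iInter_of_isOpen hQo fun t => (hGd t.1).preimage_comp_injective t.2.2
  have hbox : IsOpen (univ.pi fun V : S => (V : Set X)) :=
    isOpen_set_pi finite_univ fun V _ => hSo V V.2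
  obtain ⟨w, hwbox, hwQ⟩ := hQd.inter_open_nonempty _ hbox
    (univ_pi_nonempty_iff.mpr fun V => hSn V V.2)
  have hopen : IsOpen (⋂ t, Q t) := isOpen_iInter_of_finite hQo
  obtain ⟨δ, hδ, hball⟩ := Metric.isOpen_iff.mp hopen w hwQ
  set ρ := min δ (ε / 2) with hρ
  have hρ0 : 0 < ρ := lt_min hδ (half_pos hε)
  have hbasis : ∀ V : S, ∃ i, w V ∈ B i ∧ B i ⊆ Metric.ball (w V) ρ := by
    intro V
    obtain ⟨_, ⟨i, rfl⟩, h1, h2⟩ :=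
      hB.exists_subset_of_mem_open (Metric.mem_ball_self hρ0) Metric.isOpen_ball
    exact ⟨i, h1, h2⟩
  choose f hf1 hf2 using hbasis
  refine ⟨Finset.univ.image f, fun V hV => ⟨w ⟨V, hV⟩, hwbox ⟨V, hV⟩ (mem_univ _), ?_⟩, ?_⟩
  · exact mem_biUnion (x := f ⟨V, hV⟩) (by simp) (hf1 _)
  · intro a ha x hx hsep
    have : ∀ i, ∃ V : S, dist (x i) (w V) < ρ := by
      intro i
      obtain ⟨k, hk, hxk⟩ := mem_iUnion₂.mp (hx i)
      obtain ⟨V, -, rfl⟩ := Finset.mem_image.mp hk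
      exact ⟨V, hf2 V hxk⟩
    choose t ht using this
    have hinj : Function.Injective t := by
      intro i j hij
      by_contra hne
      have h1 := hsep i j hne
      have h2 := ht i
      have h3 := ht j
      rw [← hij] at h3
      have h4 := dist_triangle_right (x i) (x j) (w (t i))
      have h5 : ρ ≤ ε / 2 := min_le_right _ _
      linarith
    have hmem : Function.extend t x w ∈ Metric.ball w δ := by
      rw [Metric.mem_ball, dist_pi_lt_iff hδ]
      intro V
      by_cases hV : ∃ i, t i = V
      · obtain ⟨i, rfl⟩ := hV
        rw [hinj.extend_apply]
        exact (ht i).trans_le (min_le_left _ _)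
      · rw [Function.extend_apply' _ _ _ hV, dist_self]
        exact hδ
    have := mem_iInter.mp (hball hmem) (⟨⟨a, ha⟩, t, hinj⟩ : T)
    change Function.extend t x w ∘ t ∈ G a at this
    rwa [Function.extend_comp hinj] at this

end Density


section Category

variable {X : Type u}

/-- Eventually, a non-empty open set can be refined inside any number of consecutive `O k`. -/
def EventuallyRefining [TopologicalSpace X] (O : ℕ → Set X) : Prop :=
  ∀ V : Set X, IsOpen V → V.Nonempty →
    ∃ K₀, ∀ K, K₀ ≤ K → ∀ m, (V ∩ ⋂ j ∈ Ico K m, O j).Nonempty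

/-- A stage in the simultaneous construction of two points: `follow` can be refined inside the
`O k` from `stage` on, and `escape` is about to avoid the next nowhere dense set. -/
structure TwinStage [TopologicalSpace X] (O : ℕ → Set X) where
  follow : Set X
  escape : Set X
  stage : ℕ
  isOpen_follow : IsOpen follow
  isOpen_escape : IsOpen escape
  escape_nonempty : escape.Nonempty
  refining : ∀ m, (follow ∩ ⋂ j ∈ Ico stage m, O j).Nonempty

variable [MetricSpace X] {O : ℕ → Set X}

theorem TwinStage.exists_next (hO : ∀ k, IsOpen (O k)) (href : EventuallyRefining O)
    (s : TwinStage O) {G : Set X} (hGo : IsOpen G) (hGd : Dense G) {ε : ℝ} (hε : 0 < ε) :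
    ∃ s' : TwinStage O, s.stage < s'.stage ∧ closure s'.follow ⊆ s.escape ∩ G ∧
      (∀ x ∈ s'.follow, ∀ y ∈ s'.follow, dist x y ≤ ε) ∧
      s'.escape ⊆ s.follow ∩ ⋂ j ∈ Ico s.stage s'.stage, O j := by
  obtain ⟨x, hx⟩ := hGd.inter_open_nonempty _ s.isOpen_escape s.escape_nonempty
  obtain ⟨δ, hδ, hball⟩ :=
    Metric.nhds_basis_closedBall.mem_iff.mp ((s.isOpen_escape.inter hGo).mem_nhds hx)
  set ρ := min δ (ε / 2)
  have hρ : 0 < ρ := lt_min hδ (half_pos hε)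
  obtain ⟨K₀, hK₀⟩ := href (Metric.ball x ρ) Metric.isOpen_ball ⟨x, Metric.mem_ball_self hρ⟩
  refine ⟨⟨Metric.ball x ρ, s.follow ∩ ⋂ j ∈ Ico s.stage (max K₀ (s.stage + 1)), O j,
    max K₀ (s.stage + 1), Metric.isOpen_ball,
    s.isOpen_follow.inter ((finite_Ico _ _).isOpen_biInter fun j _ => hO j), s.refining _,
    hK₀ _ (le_max_left _ _)⟩, (Nat.lt_succ_self _).trans_le (le_max_right _ _), ?_, ?_, subset_rfl⟩
  · exact (Metric.closure_ball_subset_closedBall.trans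
      (Metric.closedBall_subset_closedBall (min_le_left _ _))).trans hball
  · intro y hy z hz
    have h1 := dist_triangle_right y z x
    have h2 : ρ ≤ ε / 2 := min_le_right _ _
    rw [Metric.mem_ball] at hy hz
    linarith

/-- The intersection of a decreasing sequence of non-empty sets, of vanishing diameters and
infinitely often containing the next closure, is non-empty. -/
theorem exists_mem_forall_of_antitone [CompleteSpace X] {A : ℕ → Set X} (hne : ∀ n, (A n).Nonempty)
    (hanti : Antitone A) (hcl : ∀ n, ∃ m ≥ n, closure (A (m + 1)) ⊆ A m)
    {b : ℕ → ℝ} (hb : Tendsto b atTop (𝓝 0)) {N : ℕ}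
    (hdist : ∀ n, ∀ x ∈ A (n + N), ∀ y ∈ A (n + N), dist x y ≤ b n) :
    ∃ x, ∀ n, x ∈ A n := by
  choose y hy using hne
  have hc : CauchySeq fun n => y (n + N) := by
    refine cauchySeq_of_le_tendsto_0 b (fun n m k hkn hkm => hdist k _ ?_ _ ?_) hb
    · exact hanti (by omega) (hy _)
    · exact hanti (by omega) (hy _)
  obtain ⟨x, hx⟩ := cauchySeq_tendsto_of_complete hc
  refine ⟨x, fun n => ?_⟩
  obtain ⟨m, hm, hsub⟩ := hcl n
  refine hanti hm (hsub (mem_closure_of_tendsto hx ?_))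
  filter_upwards [eventually_ge_atTop (m + 1)] with k hk
  exact hanti (by omega) (hy _)

theorem exists_dense_open_antitone {Y : Type*} [TopologicalSpace Y] [BaireSpace Y] {s : Set Y}
    (hs : s ∈ residual Y) :
    ∃ G : ℕ → Set Y, (∀ n, IsOpen (G n)) ∧ (∀ n, Dense (G n)) ∧ Antitone G ∧ ⋂ n, G n ⊆ s := by
  obtain ⟨S, ho, hd, hc, hsub⟩ := mem_residual_iff.mp hs
  rcases S.eq_empty_or_nonempty with rfl | hne
  · exact ⟨fun _ => univ, fun _ => isOpen_univ, fun _ => dense_univ, antitone_const,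
      by simpa using hsub⟩
  · obtain ⟨f, rfl⟩ := hc.exists_eq_range hne
    have hfo : ∀ n, IsOpen (f n) := fun n => ho _ ⟨n, rfl⟩
    refine ⟨fun n => ⋂ i ∈ Iic n, f i, fun n => (finite_Iic n).isOpen_biInter fun i _ => hfo i,
      fun n => dense_biInter_of_isOpen (fun i _ => hfo i) (to_countable _) fun i _ => hd _ ⟨i, rfl⟩,
      fun m n hmn => biInter_subset_biInter_left (Iic_subset_Iic.mpr hmn), ?_⟩
    rw [sInter_range] at hsub
    exact fun x hx => hsub <| mem_iInter.mpr fun n =>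
      mem_iInter₂.mp (mem_iInter.mp hx n) n (mem_Iic.mpr le_rfl)

theorem exists_mem_Ico_of_le {f : ℕ → ℕ} {j : ℕ} (h0 : f 0 ≤ j) {m : ℕ} (hm : j < f m) :
    ∃ n, j ∈ Ico (f n) (f (n + 1)) := by
  induction m with
  | zero => omega
  | succ m ih =>
    by_cases hj : j < f m
    · exact ih hj
    · exact ⟨m, not_lt.mp hj, hm⟩

/-- The set of points lying in `𝓤`-almost all of the sets `O k` is nowhere meager. -/
theorem nowhereMeager_of_ultrafilter [CompleteSpace X] (hO : ∀ k, IsOpen (O k))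
    (href : EventuallyRefining O) (𝓤 : Ultrafilter ℕ) (h𝓤 : (𝓤 : Filter ℕ) ≤ atTop) :
    NowhereMeager {x | ∀ᶠ k in (𝓤 : Filter ℕ), x ∈ O k} := by
  intro U hU hUne hM
  obtain ⟨G, hGo, hGd, hGanti, hsub⟩ := exists_dense_open_antitone hM
  obtain ⟨K₀, hK₀⟩ := href U hU hUne
  choose next hstage hfollow hdist hescape using fun (s : TwinStage O) (n : ℕ) =>
    s.exists_next hO href (hGo n) (hGd n) (Nat.one_div_pos_of_nat (α := ℝ) (n := n))
  let s : ℕ → TwinStage O := fun n =>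
    Nat.rec ⟨U, U, K₀, hU, hU, hUne, hK₀ K₀ le_rfl⟩ (fun n s => next s n) n
  have hmono : StrictMono fun n => (s n).stage := strictMono_nat_of_lt_succ fun n => hstage (s n) n
  classical
  have key : ∀ b : Prop, ∃ x ∈ U, (∀ n, x ∈ G n) ∧
      ∀ n, (Even n ↔ b) → ∀ j ∈ Ico (s n).stage (s (n + 1)).stage, x ∈ O j := by
    intro b
    let A : ℕ → Set X := fun n => if (Even n ↔ b) then (s n).follow else (s n).escape
    have hparity : ∀ n, (Even (n + 1) ↔ b) ↔ ¬ (Even n ↔ b) := fun n => by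
      rw [Nat.even_add_one]; tauto
    have hA_follow : ∀ n, (Even n ↔ b) →
        A (n + 1) ⊆ A n ∩ ⋂ j ∈ Ico (s n).stage (s (n + 1)).stage, O j := by
      intro n hn
      have hn' : ¬ (Even (n + 1) ↔ b) := fun h => (hparity n).mp h hn
      simp only [A, if_pos hn, if_neg hn']
      exact hescape (s n) n
    have hA_escape : ∀ n, ¬ (Even n ↔ b) → closure (A (n + 1)) ⊆ A n ∩ G n := by
      intro n hn
      simp only [A, if_neg hn, if_pos ((hparity n).mpr hn)]
      exact hfollow (s n) n
    have hA_succ : ∀ n, A (n + 1) ⊆ A n := by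
      intro n
      by_cases hn : Even n ↔ b
      · exact (hA_follow n hn).trans inter_subset_left
      · exact (subset_closure.trans (hA_escape n hn)).trans inter_subset_left
    have hanti : Antitone A := antitone_nat_of_succ_le hA_succ
    have hesc : ∀ n : ℕ, ∃ m ≥ n, ¬ (Even m ↔ b) := by
      intro n
      by_cases hn : Even n ↔ b
      · exact ⟨n + 1, n.le_succ, fun h => (hparity n).mp h hn⟩
      · exact ⟨n, le_rfl, hn⟩
    have hne : ∀ n, (A n).Nonempty := by
      intro n
      by_cases hn : Even n ↔ b
      · simp only [A, if_pos hn]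
        exact ((s n).refining 0).mono inter_subset_left
      · simp only [A, if_neg hn]
        exact (s n).escape_nonempty
    have hAdist : ∀ n, (Even (n + 1) ↔ b) → ∀ x ∈ A (n + 1), ∀ y ∈ A (n + 1),
        dist x y ≤ 1 / ((n : ℝ) + 1) := by
      intro n hn
      simp only [A, if_pos hn]
      exact hdist (s n) n
    obtain ⟨x, hx⟩ := exists_mem_forall_of_antitone hne hanti
      (fun n => by
        obtain ⟨m, hm, hmb⟩ := hesc n
        exact ⟨m, hm, (hA_escape m hmb).trans inter_subset_left⟩)
      (b := fun n => 1 / ((n : ℝ) + 1)) tendsto_one_div_add_atTop_nhds_zero_nat (N := 2)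
      (fun n x hx y hy => by
        by_cases hn : Even (n + 1) ↔ b
        · exact hAdist n hn x (hA_succ _ hx) y (hA_succ _ hy)
        · refine (hAdist (n + 1) ((hparity _).mpr hn) x hx y hy).trans ?_
          exact Nat.one_div_le_one_div n.le_succ)
    refine ⟨x, ?_, fun n => ?_, fun n hn j hj => ?_⟩
    · have := hx 0
      by_cases hb : Even 0 ↔ b
      · simp only [A, if_pos hb] at this
        exact this
      · simp only [A, if_neg hb] at this
        exact this
    · obtain ⟨m, hm, hmb⟩ := hesc n
      exact hGanti hm (hA_escape m hmb (subset_closure (hx (m + 1)))).2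
    · exact mem_iInter₂.mp (hA_follow n hn (hx (n + 1))).2 j hj
  have hcover : ∀ᶠ j in (𝓤 : Filter ℕ),
      (∃ n, (Even n ↔ True) ∧ j ∈ Ico (s n).stage (s (n + 1)).stage) ∨
      (∃ n, (Even n ↔ False) ∧ j ∈ Ico (s n).stage (s (n + 1)).stage) := by
    filter_upwards [h𝓤 (eventually_ge_atTop (s 0).stage)] with j hj
    obtain ⟨n, hn⟩ := exists_mem_Ico_of_le (f := fun n => (s n).stage) hj (m := j + 1)
      ((Nat.lt_succ_self j).trans_le (hmono.le_apply))
    by_cases he : Even n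
    · exact Or.inl ⟨n, by simp [he], hn⟩
    · exact Or.inr ⟨n, by simp [he], hn⟩
  have hfinal : ∀ b : Prop,
      ¬ ∀ᶠ j in (𝓤 : Filter ℕ), ∃ n, (Even n ↔ b) ∧ j ∈ Ico (s n).stage (s (n + 1)).stage := by
    intro b hb
    obtain ⟨x, hxU, hxG, hxO⟩ := key b
    refine hsub (mem_iInter.mpr hxG) ⟨?_, hxU⟩
    filter_upwards [hb] with j ⟨n, hn, hj⟩
    exact hxO n hn j hj
  exact (Ultrafilter.eventually_or.mp hcover).elim (hfinal True) (hfinal False)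

end Category


section Sequence

variable {X : Type u}

/-- The open set coded by the `k`-th entry of a list of finite sets of indices. -/
def codedSet (B : ℕ → Set X) (l : List (Finset ℕ)) (k : ℕ) : Set X :=
  ⋃ i ∈ l.getD k ∅, B i

/-- Each basic set `B i` can be refined inside any consecutive coded sets after the `i`-th one. -/
def IsRefining (B : ℕ → Set X) (l : List (Finset ℕ)) : Prop :=
  ∀ i K m, i ≤ K → K ≤ m → m ≤ l.length → (B i ∩ ⋂ j ∈ Ico K m, codedSet B l j).Nonempty

theorem codedSet_append (B : ℕ → Set X) {l : List (Finset ℕ)} (l' : List (Finset ℕ)) {k : ℕ}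
    (hk : k < l.length) : codedSet B (l ++ l') k = codedSet B l k := by
  rw [codedSet, codedSet, List.getD_append _ _ _ _ hk]

theorem codedSet_of_prefix (B : ℕ → Set X) {l l' : List (Finset ℕ)} (h : l <+: l') {k : ℕ}
    (hk : k < l.length) : codedSet B l' k = codedSet B l k := by
  obtain ⟨t, rfl⟩ := h
  exact codedSet_append B t hk

theorem codedSet_concat (B : ℕ → Set X) (l : List (Finset ℕ)) (s : Finset ℕ) :
    codedSet B (l ++ [s]) l.length = ⋃ i ∈ s, B i := by
  simp [codedSet]

theorem isOpen_codedSet [TopologicalSpace X] {B : ℕ → Set X} (hB : ∀ i, IsOpen (B i))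
    (l : List (Finset ℕ)) (k : ℕ) : IsOpen (codedSet B l k) :=
  isOpen_biUnion fun i _ => hB i

theorem isRefining_nil {B : ℕ → Set X} (hB : ∀ i, (B i).Nonempty) : IsRefining B [] := by
  intro i K m _ _ hm
  have : m = 0 := by simpa using hm
  subst this
  simpa using hB i

theorem IsRefining.concat {B : ℕ → Set X} {l : List (Finset ℕ)} (hl : IsRefining B l)
    (hB : ∀ i, (B i).Nonempty) {s : Finset ℕ}
    (hs : ∀ i K, i ≤ K → K ≤ l.length →
      ((B i ∩ ⋂ j ∈ Ico K l.length, codedSet B l j) ∩ ⋃ i ∈ s, B i).Nonempty) :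
    IsRefining B (l ++ [s]) := by
  intro i K m hiK hKm hm
  rw [List.length_append, List.length_singleton] at hm
  rcases hm.lt_or_eq with hlt | rfl
  · obtain ⟨x, hx, hxO⟩ := hl i K m hiK hKm (by omega)
    refine ⟨x, hx, mem_iInter₂.mpr fun j hj => ?_⟩
    rw [codedSet_append B _ (by have := hj.2; omega)]
    exact mem_iInter₂.mp hxO j hj
  · rcases hKm.lt_or_eq with hlt | rfl
    · obtain ⟨x, ⟨hx, hxO⟩, hxs⟩ := hs i K hiK (by omega)
      refine ⟨x, hx, mem_iInter₂.mpr fun j hj => ?_⟩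
      rcases (Nat.lt_succ_iff.mp hj.2).lt_or_eq with hj' | rfl
      · rw [codedSet_append B _ hj']
        exact mem_iInter₂.mp hxO j ⟨hj.1, hj'⟩
      · rwa [codedSet_concat]
    · simpa using hB i

variable [MetricSpace X] [CompleteSpace X] {B : ℕ → Set X}

theorem IsRefining.exists_concat (hbasis : TopologicalSpace.IsTopologicalBasis (range B))
    (hB : ∀ i, (B i).Nonempty) {l : List (Finset ℕ)} (hl : IsRefining B l)
    {α : Type*} (E : Finset α) (n : α → ℕ) (G : ∀ a, Set (Fin (n a) → X))
    (hGo : ∀ a, IsOpen (G a)) (hGd : ∀ a, Dense (G a)) {ε : ℝ} (hε : 0 < ε) :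
    ∃ s : Finset ℕ, IsRefining B (l ++ [s]) ∧
      ∀ a ∈ E, SeparatedTuplesIn (codedSet B (l ++ [s]) l.length) ε (G a) := by
  have hBo : ∀ i, IsOpen (B i) := fun i => hbasis.isOpen ⟨i, rfl⟩
  let I : Set (ℕ × ℕ) := {q | q.1 ≤ q.2 ∧ q.2 ≤ l.length}
  have hI : I.Finite := ((finite_Iic l.length).prod (finite_Iic l.length)).subset
    fun q hq => ⟨hq.1.trans hq.2, hq.2⟩
  obtain ⟨s, hs, hsE⟩ := exists_finset_separatedTuplesIn hbasis
    (hI.image fun q => B q.1 ∩ ⋂ j ∈ Ico q.2 l.length, codedSet B l j)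
    (by
      rintro _ ⟨q, -, rfl⟩
      exact (hBo _).inter ((finite_Ico _ _).isOpen_biInter fun j _ => isOpen_codedSet hBo l j))
    (by
      rintro _ ⟨q, hq, rfl⟩
      exact hl _ _ _ hq.1 hq.2 le_rfl)
    E n G hGo hGd hε
  refine ⟨s, hl.concat hB fun i K hiK hK => hs _ ⟨(i, K), ⟨hiK, hK⟩, rfl⟩, ?_⟩
  rwa [codedSet_concat]

theorem IsRefining.exists_prefix (hbasis : TopologicalSpace.IsTopologicalBasis (range B))
    (hB : ∀ i, (B i).Nonempty) {l : List (Finset ℕ)} (hl : IsRefining B l) (N : ℕ) :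
    ∃ l', IsRefining B l' ∧ l <+: l' ∧ N ≤ l'.length := by
  induction N with
  | zero => exact ⟨l, hl, List.prefix_rfl, Nat.zero_le _⟩
  | succ N ih =>
    obtain ⟨l', hl', hpre, hN⟩ := ih
    obtain ⟨s, hs, -⟩ := hl'.exists_concat hbasis hB (∅ : Finset Empty) (fun _ => 0)
      (fun _ => univ) (fun _ => isOpen_univ) (fun _ => dense_univ) one_pos
    exact ⟨_, hs, hpre.trans (List.prefix_append _ _), by simpa using hN⟩

theorem exists_eventuallyRefining [SecondCountableTopology X] [Nonempty X] {α : Type u}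
    (hcard : Cardinal.mk (Finset α × ℕ) < Cardinal.lift.{u} addMeager)
    (n : α → ℕ) (G : ∀ a, Set (Fin (n a) → X))
    (hGo : ∀ a, IsOpen (G a)) (hGd : ∀ a, Dense (G a)) :
    ∃ O : ℕ → Set X, (∀ k, IsOpen (O k)) ∧ EventuallyRefining O ∧
      ∀ (E : Finset α) (N : ℕ), ∃ k ≥ N, ∀ a ∈ E, SeparatedTuplesIn (O k) (1 / (k + 1)) (G a) := by
  obtain ⟨b, hbc, hbe, hb⟩ := TopologicalSpace.exists_countable_basis X
  obtain ⟨V, hV, -⟩ := hb.exists_subset_of_mem_open (mem_univ (Classical.arbitrary X)) isOpen_univ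
  obtain ⟨B, rfl⟩ := hbc.exists_eq_range ⟨V, hV⟩
  have hB : ∀ i, (B i).Nonempty := fun i =>
    nonempty_iff_ne_empty.mpr fun h => hbe (h ▸ mem_range_self i)
  have hBo : ∀ i, IsOpen (B i) := fun i => hb.isOpen ⟨i, rfl⟩
  let P := {l : List (Finset ℕ) // IsRefining B l}
  have : Nonempty P := ⟨⟨[], isRefining_nil hB⟩⟩
  let D : Finset α × ℕ → Set P := fun d => {l | ∃ k < l.1.length, d.2 ≤ k ∧
    ∀ a ∈ d.1, SeparatedTuplesIn (codedSet B l.1 k) (1 / (k + 1)) (G a)}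
  obtain ⟨p, hp, hpD⟩ := exists_generic_chain (fun l l' : P => l.1 <+: l'.1)
    (fun l => List.prefix_rfl) D
    (fun d l => by
      obtain ⟨l', hl', hpre, hlen⟩ := l.2.exists_prefix hb hB d.2
      obtain ⟨s, hs, hsE⟩ := hl'.exists_concat hb hB d.1 n G hGo hGd
        (Nat.one_div_pos_of_nat (α := ℝ) (n := l'.length))
      exact ⟨⟨_, hs⟩, ⟨l'.length, by simp, hlen, hsE⟩, hpre.trans (List.prefix_append _ _)⟩)
    hcard
  have hmono : ∀ s t, s ≤ t → (p s).1 <+: (p t).1 := fun s t hst =>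
    Nat.le_induction List.prefix_rfl (fun t _ ih => ih.trans (hp t)) t hst
  have hlen : ∀ k, ∃ t, k < (p t).1.length := fun k => by
    obtain ⟨t, k', hk', hkk', -⟩ := hpD (∅, k)
    exact ⟨t, hkk'.trans_lt hk'⟩
  choose T hT using hlen
  have hO : ∀ k t, k < (p t).1.length → codedSet B (p (T k)).1 k = codedSet B (p t).1 k := by
    intro k t hk
    rcases le_total (T k) t with h | h
    · exact (codedSet_of_prefix B (hmono _ _ h) (hT k)).symm
    · exact codedSet_of_prefix B (hmono _ _ h) hk
  refine ⟨fun k => codedSet B (p (T k)).1 k, fun k => isOpen_codedSet hBo _ _, ?_, ?_⟩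
  · intro V hV ⟨x, hx⟩
    obtain ⟨_, ⟨i, rfl⟩, -, hiV⟩ := hb.exists_subset_of_mem_open hx hV
    refine ⟨i, fun K hK m => ?_⟩
    rcases le_or_gt K m with hKm | hKm
    · obtain ⟨y, hy, hyO⟩ := (p (T m)).2 i K m hK hKm (hT m).le
      refine ⟨y, hiV hy, mem_iInter₂.mpr fun j hj => ?_⟩
      beta_reduce
      rw [hO j (T m) (hj.2.trans (hT m))]
      exact mem_iInter₂.mp hyO j hj
    · rw [Ico_eq_empty (by omega)]
      simpa using ⟨x, hx⟩
  · intro E N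
    obtain ⟨t, k, hk, hNk, hkE⟩ := hpD (E, N)
    refine ⟨k, hNk, fun a ha => ?_⟩
    beta_reduce
    rw [hO k t hk]
    exact hkE a ha

end Sequence

section Main

theorem eventually_lt_dist_of_injective {X : Type*} [MetricSpace X] {n : ℕ} {x : Fin n → X}
    (hx : Function.Injective x) :
    ∀ᶠ k : ℕ in atTop, ∀ i j, i ≠ j → 1 / ((k : ℝ) + 1) < dist (x i) (x j) := by
  simp only [eventually_all]
  intro i j hij
  exact tendsto_one_div_add_atTop_nhds_zero_nat.eventually_lt_const
    (dist_pos.mpr (hx.ne hij))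

theorem exists_ultrafilter_le_atTop {β : Type*} (D : β → Set ℕ)
    (hD : ∀ (E : Finset β) (N : ℕ), ∃ k ≥ N, ∀ a ∈ E, k ∈ D a) :
    ∃ 𝓤 : Ultrafilter ℕ, (𝓤 : Filter ℕ) ≤ atTop ∧ ∀ a, D a ∈ 𝓤 := by
  classical
  have hne : (⨅ d : Finset β × ℕ, 𝓟 {k | d.2 ≤ k ∧ ∀ a ∈ d.1, k ∈ D a}).NeBot := by
    refine iInf_neBot_of_directed (fun d d' => ⟨(d.1 ∪ d'.1, max d.2 d'.2), ?_, ?_⟩) fun d => ?_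
    · exact principal_mono.mpr fun k hk => ⟨(le_max_left _ _).trans hk.1,
        fun a ha => hk.2 a (Finset.mem_union_left _ ha)⟩
    · exact principal_mono.mpr fun k hk => ⟨(le_max_right _ _).trans hk.1,
        fun a ha => hk.2 a (Finset.mem_union_right _ ha)⟩
    · obtain ⟨k, hk, hkD⟩ := hD d.1 d.2
      exact principal_neBot_iff.mpr ⟨k, hk, hkD⟩
  have hmem : ∀ d : Finset β × ℕ, {k | d.2 ≤ k ∧ ∀ a ∈ d.1, k ∈ D a} ∈ Ultrafilter.of
      (⨅ d : Finset β × ℕ, 𝓟 {k | d.2 ≤ k ∧ ∀ a ∈ d.1, k ∈ D a}) := fun d =>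
    Ultrafilter.of_le _ (mem_iInf_of_mem d (mem_principal_self _))
  refine ⟨_, ?_, fun a => mem_of_superset (hmem ({a}, 0)) fun k hk => hk.2 a (by simp)⟩
  rw [atTop, le_iInf_iff]
  intro N
  rw [le_principal_iff]
  exact mem_of_superset (hmem (∅, N)) fun k hk => hk.1

theorem corollary4p3 {X : Type u} [TopologicalSpace X] [PolishSpace X]
    [Nonempty X] [PerfectSpace X]
    (Rs : Set (FinRel X)) (hmeager : ∀ R ∈ Rs, R.Meager)
    (hcard : Cardinal.mk Rs < Cardinal.lift.{u} addMeager) :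
    ∃ F : Set X, NowhereMeager F ∧ IsFreeFor Rs F := by
  let := TopologicalSpace.upgradeIsCompletelyMetrizable X
  choose G hGo hGd _ hGsub using fun R : Rs => exists_dense_open_antitone (hmeager R R.2)
  obtain ⟨O, hO, href, hsep⟩ := exists_eventuallyRefining (mk_finset_prod_nat_lt hcard)
    (fun a => a.1.1.arity) (fun a => G a.1 a.2) (fun a => hGo a.1 a.2) (fun a => hGd a.1 a.2)
  obtain ⟨𝓤, h𝓤, hD⟩ := exists_ultrafilter_le_atTop
    (fun a : Rs × ℕ => {k | SeparatedTuplesIn (O k) (1 / (k + 1)) (G a.1 a.2)}) hsep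
  refine ⟨_, nowhereMeager_of_ultrafilter hO href 𝓤 h𝓤, fun R hR x hxF hinj hxR => ?_⟩
  refine hGsub ⟨R, hR⟩ (mem_iInter.mpr fun m => ?_) hxR
  obtain ⟨k, hkD, hkF, hkx⟩ := ((Filter.Eventually.and (hD (⟨R, hR⟩, m))
    ((eventually_all.mpr hxF).and (h𝓤 (eventually_lt_dist_of_injective hinj))))).exists
  exact hkD x hkF hkx

end Main
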